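/- Let $P$ be a finite set of $n$ points in the plane, no three collinear and no two on a horizontal line. For $0<\beta<\pi$, the lines through the origin with slopes $0$ and $\tan\beta$ cut the plane into four open sectors (top-right, top-left, bottom-left, bottom-right); the translates of these are the $\mathcal{O}_\beta$-quadrants of the four kinds, and a set is $P$-free if it contains no point of $P$. The $\mathcal{O}_\beta$-hull of $P$ is the plane minus the union of all $P$-free $\mathcal{O}_\beta$-quadrants; its vertices are the points of $P$ on its boundary. For each kind, the $\mathcal{O}_\beta$-staircase is the part, between the horizontally extreme and the vertically extreme vertex of the hull in the direction of that kind (with respect to the coordinate system of the two lines), of the boundary of the plane minus all $P$-free quadrants of that kind. Two consecutive vertices $p,q$ of a staircase, $p$ being nearer to its horizontally extreme end, support a maximal quadrant: the quadrant of that kind whose boundary rays lie on the horizontal line through $p$ and on the line of slope $\tan\beta$ through $q$. An overlapping region is a nonempty intersection of two maximal quadrants of opposite kinds (top-right and bottom-left, or top-left and bottom-right); it is identified, as $\beta$ varies, by the kinds and the two pairs of supporting vertices. While $\beta$ increases from $0$ to $\pi$, an insertion (resp. deletion) event is an angle $\beta\in(0,\pi)$ together with a point of $P$ and one of the four staircases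 such that the point joins (resp. leaves) the vertex set of that staircase at $\beta$; an overlap (resp. release) event is an angle $\beta\in(0,\pi)$ together with an overlapping region that is created (resp. destroyed) at $\beta$. Then the total number of insertion, deletion, overlap and release events is $O(n)$: there is an absolute constant $C$ such that for every such $P$ there are at most $Cn$ events. -/

import Mathlib

open Filter Topology

noncomputable section

namespace BetaHull

/-- The four kinds of quadrants cut out by a horizontal line and a line of slope `tan β`. -/
inductive Kind where
  | topRight
  | topLeft
  | bottomLeft
  | bottomRight

/-- The kind of the opposite quadrant. -/
def Kind.opp : Kind → Kind
  | .topRight => .bottomLeft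
  | .topLeft => .bottomRight
  | .bottomLeft => .topRight
  | .bottomRight => .topLeft

/-- `+1` for the right kinds, `-1` for the left kinds. -/
def Kind.signX : Kind → ℝ
  | .topRight => 1
  | .topLeft => -1
  | .bottomLeft => -1
  | .bottomRight => 1

/-- `+1` for the top kinds, `-1` for the bottom kinds. -/
def Kind.signY : Kind → ℝ
  | .topRight => 1
  | .topLeft => 1
  | .bottomLeft => -1
  | .bottomRight => -1

/-- The horizontal coordinate of `z` in the oblique coordinate system whose axes are the lines
through the origin with slopes `0` and `tan β` (for `0 < β < π`): if
`z = s • (1, 0) + t • (cos β, sin β)`, then this is `s`. -/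
def obliqueX (β : ℝ) (z : ℝ × ℝ) : ℝ := z.1 - z.2 * Real.cot β

/-- The oblique horizontal coordinate, oriented so that it increases towards the side of `σ`. -/
def Kind.h (σ : Kind) (β : ℝ) (z : ℝ × ℝ) : ℝ := σ.signX * obliqueX β z

/-- The vertical coordinate, oriented so that it increases towards the side of `σ`. (It is a
positive multiple, by the factor `sin β`, of the second oblique coordinate.) -/
def Kind.k (σ : Kind) (z : ℝ × ℝ) : ℝ := σ.signY * z.2

/-- The open `O_β`-quadrant of kind `σ` with apex `a`. -/
def quadrant (β : ℝ) (σ : Kind) (a : ℝ × ℝ) : Set (ℝ × ℝ) :=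
  {z | σ.h β a < σ.h β z ∧ σ.k a < σ.k z}

/-- In oblique coordinates: the quadrant of kind `σ` with apex `a` is the translate to `a` of the
open sector spanned by `± (1, 0)` and `± (cos β, sin β)`. -/
theorem mem_quadrant_iff {β : ℝ} (h0 : 0 < β) (h1 : β < Real.pi) (σ : Kind) (a z : ℝ × ℝ) :
    z ∈ quadrant β σ a ↔ ∃ s t : ℝ, 0 < s ∧ 0 < t ∧
      z = a + (σ.signX * s) • ((1 : ℝ), (0 : ℝ)) +
        (σ.signY * t) • (Real.cos β, Real.sin β) := by
  have hs : 0 < Real.sin β := Real.sin_pos_of_pos_of_lt_pi h0 h1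
  have hX : σ.signX * σ.signX = 1 := by cases σ <;> norm_num [Kind.signX]
  have hY : σ.signY * σ.signY = 1 := by cases σ <;> norm_num [Kind.signY]
  have hc : Real.cot β * Real.sin β = Real.cos β := by
    rw [Real.cot_eq_cos_div_sin]; field_simp
  constructor
  · rintro ⟨hh, hk⟩
    simp only [Kind.h, Kind.k, obliqueX] at hh hk
    refine ⟨σ.signX * ((z.1 - z.2 * Real.cot β) - (a.1 - a.2 * Real.cot β)),
      σ.signY * (z.2 - a.2) / Real.sin β, by linarith, div_pos (by linarith) hs, ?_⟩
    have e1 : σ.signY * (σ.signY * (z.2 - a.2) / Real.sin β) = (z.2 - a.2) / Real.sin β := by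
      rw [mul_div_assoc', ← mul_assoc, hY, one_mul]
    rw [← mul_assoc, hX, one_mul, e1]
    ext
    · simp [Real.cot_eq_cos_div_sin]; field_simp; ring
    · simp; field_simp; ring
  · rintro ⟨s, t, hs0, ht0, rfl⟩
    simp only [quadrant, Kind.h, Kind.k, obliqueX, Set.mem_ofPred_eq, Prod.fst_add, Prod.snd_add,
      Prod.smul_mk, smul_eq_mul]
    constructor
    · have : σ.signX * (a.1 + σ.signX * s * 1 + σ.signY * t * Real.cos β -
          (a.2 + σ.signX * s * 0 + σ.signY * t * Real.sin β) * Real.cot β) =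
          σ.signX * (a.1 - a.2 * Real.cot β) + s := by
        rw [← hc]; linear_combination s * hX
      rw [this]; linarith
    · have : 0 < t * Real.sin β := mul_pos ht0 hs
      have e : σ.signY * (a.2 + σ.signX * s * 0 + σ.signY * t * Real.sin β) =
          σ.signY * a.2 + t * Real.sin β := by linear_combination t * Real.sin β * hY
      rw [e]; linarith

/-- A set is `P`-free if it contains no element of `P`. -/
def PFree (P : Finset (ℝ × ℝ)) (Q : Set (ℝ × ℝ)) : Prop := ∀ p ∈ P, p ∉ Q

/-- The `O_β`-hull of `P`: the plane minus all `P`-free `O_β`-quadrants. -/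
def hull (P : Finset (ℝ × ℝ)) (β : ℝ) : Set (ℝ × ℝ) :=
  {z | ∀ (σ : Kind) (a : ℝ × ℝ), PFree P (quadrant β σ a) → z ∉ quadrant β σ a}

/-- The vertices of the `O_β`-hull: the elements of `P` that lie on its boundary. -/
def hullVertices (P : Finset (ℝ × ℝ)) (β : ℝ) : Set (ℝ × ℝ) :=
  {p | p ∈ P ∧ p ∈ frontier (hull P β)}

/-- The plane minus all `P`-free `O_β`-quadrants of the single kind `σ`. -/
def sideRegion (P : Finset (ℝ × ℝ)) (β : ℝ) (σ : Kind) : Set (ℝ × ℝ) :=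
  {z | ∀ a : ℝ × ℝ, PFree P (quadrant β σ a) → z ∉ quadrant β σ a}

/-- The `O_β`-staircase of kind `σ`: the part of the boundary of `sideRegion P β σ` between
a vertex `r` of the hull that is horizontally extreme towards `σ` and a vertex `t` of the hull that
is vertically extreme towards `σ`, in the coordinate system of the two lines. (For the top-right
staircase: from the rightmost vertex to the topmost vertex.) -/
def staircase (P : Finset (ℝ × ℝ)) (β : ℝ) (σ : Kind) : Set (ℝ × ℝ) :=
  {z | z ∈ frontier (sideRegion P β σ) ∧
    ∃ r ∈ hullVertices P β, ∃ t ∈ hullVertices P β,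
      (∀ q ∈ hullVertices P β, σ.h β q ≤ σ.h β r) ∧
      (∀ q ∈ hullVertices P β, σ.k q ≤ σ.k t) ∧
      σ.h β t ≤ σ.h β z ∧ σ.k r ≤ σ.k z}

/-- The vertices of the hull that lie on the staircase of kind `σ`. -/
def stairVertices (P : Finset (ℝ × ℝ)) (β : ℝ) (σ : Kind) : Set (ℝ × ℝ) :=
  hullVertices P β ∩ staircase P β σ

/-- `p`, `q` are consecutive vertices of the staircase of kind `σ`, traversed from its horizontally
extreme to its vertically extreme end (so that `σ.k` increases). -/
def Consecutive (P : Finset (ℝ × ℝ)) (β : ℝ) (σ : Kind) (p q : ℝ × ℝ) : Prop :=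
  p ∈ stairVertices P β σ ∧ q ∈ stairVertices P β σ ∧ σ.k p < σ.k q ∧
    ∀ w ∈ stairVertices P β σ, ¬ (σ.k p < σ.k w ∧ σ.k w < σ.k q)

/-- The intersection of the horizontal line through `p` with the line of slope `tan β`
through `q`. -/
def corner (β : ℝ) (p q : ℝ × ℝ) : ℝ × ℝ := (q.1 + (p.2 - q.2) * Real.cot β, p.2)

/-- The quadrant of kind `σ` supported by `p` and `q`: its two boundary rays lie on the horizontal
line through `p` and on the line of slope `tan β` through `q`. For consecutive vertices of the
staircase of kind `σ`, these are the maximal quadrants of that kind. -/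
def supportedQuadrant (β : ℝ) (σ : Kind) (p q : ℝ × ℝ) : Set (ℝ × ℝ) :=
  quadrant β σ (corner β p q)

/-- The combinatorial description of an overlapping region: the kind (top-right or top-left) of
the upper one of the two overlapping maximal quadrants, and the two pairs of consecutive vertices
that support the upper and the lower one. -/
structure RegionLabel where
  kind : Kind
  p : ℝ × ℝ
  q : ℝ × ℝ
  p' : ℝ × ℝ
  q' : ℝ × ℝ

/-- At the angle `β`, the label `r` describes an overlapping region of the hull: a nonempty
intersection of two opposite maximal quadrants. The restriction of the kind makes each unordered
pair of opposite maximal quadrants have exactly one label. -/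
def IsOverlapping (P : Finset (ℝ × ℝ)) (β : ℝ) (r : RegionLabel) : Prop :=
  (r.kind = Kind.topRight ∨ r.kind = Kind.topLeft) ∧
  Consecutive P β r.kind r.p r.q ∧
  Consecutive P β r.kind.opp r.p' r.q' ∧
  (supportedQuadrant β r.kind r.p r.q ∩ supportedQuadrant β r.kind.opp r.p' r.q').Nonempty

/-- A property depending on the angle starts to hold at `β`: either it holds at `β` and fails at
angles arbitrarily close below `β`, or it fails at `β` and holds at angles arbitrarily close
above `β`. -/
def StartsAt (f : ℝ → Prop) (β : ℝ) : Prop :=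
  (f β ∧ ∃ᶠ x in 𝓝[<] β, ¬ f x) ∨ (¬ f β ∧ ∃ᶠ x in 𝓝[>] β, f x)

/-- A property depending on the angle ceases to hold at `β`. -/
def EndsAt (f : ℝ → Prop) (β : ℝ) : Prop := StartsAt (fun x => ¬ f x) β

/-- The possible events of the sweep, with the angle at which they occur and the staircase and
vertex, or the overlapping region, that they concern. -/
inductive Event where
  | insertion (β : ℝ) (σ : Kind) (p : ℝ × ℝ)
  | deletion (β : ℝ) (σ : Kind) (p : ℝ × ℝ)
  | overlap (β : ℝ) (r : RegionLabel)
  | release (β : ℝ) (r : RegionLabel)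

/-- The angle of an event. -/
def Event.angle : Event → ℝ
  | .insertion β _ _ => β
  | .deletion β _ _ => β
  | .overlap β _ => β
  | .release β _ => β

/-- The event really happens when the angle increases: a vertex joins or leaves a staircase, an
overlapping region is created or destroyed. -/
def Event.Occurs (P : Finset (ℝ × ℝ)) : Event → Prop
  | .insertion β σ p => StartsAt (fun x => p ∈ stairVertices P x σ) β
  | .deletion β σ p => EndsAt (fun x => p ∈ stairVertices P x σ) β
  | .overlap β r => StartsAt (fun x => IsOverlapping P x r) β
  | .release β r => EndsAt (fun x => IsOverlapping P x r) β

/-- All events of the angular sweep in which the angle runs from `0` to `π`. -/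
def sweepEvents (P : Finset (ℝ × ℝ)) : Set Event :=
  {e | 0 < e.angle ∧ e.angle < Real.pi ∧ e.Occurs P}

/-- No three points of `P` are collinear, and no two lie on a horizontal line. -/
def GeneralPosition (P : Finset (ℝ × ℝ)) : Prop :=
  (∀ p ∈ P, ∀ q ∈ P, ∀ r ∈ P, p ≠ q → p ≠ r → q ≠ r → ¬ Collinear ℝ {p, q, r}) ∧
  (∀ p ∈ P, ∀ q ∈ P, p ≠ q → p.2 ≠ q.2)

end BetaHull

end

/-! In coordinates oriented towards a kind `σ`, write `u`, `v` for the signed abscissa and ordinate.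
The oblique horizontal coordinate is then `u - t * v` with `t = ± cot β`, which is monotone in `β`
on `(0, π)`. The vertices of the staircase are the points of `P` maximal for the pair `(u - t v,
v)`. A larger `t` penalises higher points more, so this set only grows with `t`. Hence each of the
`4n` pairs (kind, point) causes at most one insertion and one deletion.

For overlaps, charge a consecutive pair to whichever of its two points appears later: at that moment
the other is already present, and it stays the neighbour as long as the two are consecutive. So at
most `2n` pairs are ever consecutive on a staircase (`encard_consec_le`). As `t` grows, an overlap
can end only when one of its supporting pairs ceases to be consecutive (`Overlaps.persists`). Charge
it to the pair that breaks first. Since a maximal quadrant meets at most one opposite maximal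
quadrant at a time (`Overlaps.unique`), this charging is injective. It gives at most `2n + 2n`
regions for each of the two choices of opposite kinds.

Each region exists on an interval of angles, so it is created and destroyed at most once. The total
is at most `4n + 4n + 8n + 8n = 24n`. -/

namespace BetaHull

/-! ### Consecutive elements of a monotone family of sets -/

section Nested

variable {α : Type*} {V : ℝ → Set α} {k : α → ℝ} {s t : ℝ} {p q : α}

/-- `p` and `q` are consecutive elements of `V t` with respect to the height `k`. -/
def Consec (V : ℝ → Set α) (k : α → ℝ) (t : ℝ) (p q : α) : Prop :=
  p ∈ V t ∧ q ∈ V t ∧ k p < k q ∧ ∀ w ∈ V t, ¬ (k p < k w ∧ k w < k q)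

theorem Consec.of_between (hV : Monotone V) {r : ℝ} (hr : Consec V k r p q) (hrs : r ≤ s)
    (hst : s ≤ t) (ht : Consec V k t p q) : Consec V k s p q :=
  ⟨hV hrs hr.1, hV hrs hr.2.1, hr.2.2.1, fun w hw => ht.2.2.2 w (hV hst hw)⟩

/-- Under `h`, the later neighbour is already present at time `s`, and the earlier one is still
present at time `t`. Neither can then lie strictly below the other without separating a consecutive
pair. -/
theorem Consec.upper_unique (hV : Monotone V) {P : Set α} (hP : ∀ t, V t ⊆ P)
    (hk : Set.InjOn k P) {q₁ q₂ : α} (hst : s ≤ t) (h₁ : Consec V k s p q₁)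
    (h₂ : Consec V k t p q₂) (h : p ∈ V s → q₂ ∈ V s) : q₁ = q₂ := by
  refine hk (hP _ h₁.2.1) (hP _ h₂.2.1) (le_antisymm ?_ ?_)
  · by_contra! hlt
    exact h₁.2.2.2 q₂ (h h₁.1) ⟨h₂.2.2.1, hlt⟩
  · by_contra! hlt
    exact h₂.2.2.2 q₁ (hV hst h₁.2.1) ⟨h₁.2.2.1, hlt⟩

theorem Consec.lower_unique (hV : Monotone V) {P : Set α} (hP : ∀ t, V t ⊆ P)
    (hk : Set.InjOn k P) {p₁ p₂ : α} (hst : s ≤ t) (h₁ : Consec V k s p₁ q)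
    (h₂ : Consec V k t p₂ q) (h : q ∈ V s → p₂ ∈ V s) : p₁ = p₂ := by
  refine hk (hP _ h₁.1) (hP _ h₂.1) (le_antisymm ?_ ?_)
  · by_contra! hlt
    exact h₂.2.2.2 p₁ (hV hst h₁.1) ⟨hlt, h₁.2.2.1⟩
  · by_contra! hlt
    exact h₁.2.2.2 p₂ (h h₁.2.1) ⟨hlt, h₂.2.2.1⟩

/-- The sets of times at which `p` and `q` are present are both upward closed in `ℝ`, so one
contains the other. -/
theorem mem_imp_or_mem_imp (hV : Monotone V) (p q : α) :
    (∀ t, p ∈ V t → q ∈ V t) ∨ (∀ t, q ∈ V t → p ∈ V t) := by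
  by_contra! h
  obtain ⟨⟨s, hps, hqs⟩, t, hqt, hpt⟩ := h
  rcases le_total s t with hst | hts
  · exact hpt (hV hst hps)
  · exact hqs (hV hts hqt)

/-- In a monotone family of subsets of `P`, at most `2 |P|` pairs are ever consecutive. -/
theorem encard_consec_le (hV : Monotone V) {P : Set α} (hP : ∀ t, V t ⊆ P)
    (hk : Set.InjOn k P) :
    {x : α × α | ∃ t, Consec V k t x.1 x.2}.encard ≤ 2 * P.encard := by
  -- In `A` the lower point arrives no earlier than the upper one and determines it; `B` is the
  -- mirror case.
  set A := {x : α × α | (∃ t, Consec V k t x.1 x.2) ∧ ∀ t, x.1 ∈ V t → x.2 ∈ V t}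
  set B := {x : α × α | (∃ t, Consec V k t x.1 x.2) ∧ ∀ t, x.2 ∈ V t → x.1 ∈ V t}
  have hA : A.encard ≤ P.encard := by
    refine Set.encard_le_encard_of_injOn (f := Prod.fst) ?_ ?_
    · rintro x ⟨⟨t, ht⟩, -⟩
      exact hP t ht.1
    · rintro ⟨p, q₁⟩ ⟨⟨s, hs⟩, h₁⟩ ⟨p', q₂⟩ ⟨⟨t, ht⟩, h₂⟩ (rfl : p = p')
      rcases le_total s t with hst | hts
      · exact Prod.ext rfl (hs.upper_unique hV hP hk hst ht (h₂ s))
      · exact Prod.ext rfl (ht.upper_unique hV hP hk hts hs (h₁ t)).symm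
  have hB : B.encard ≤ P.encard := by
    refine Set.encard_le_encard_of_injOn (f := Prod.snd) ?_ ?_
    · rintro x ⟨⟨t, ht⟩, -⟩
      exact hP t ht.2.1
    · rintro ⟨p₁, q⟩ ⟨⟨s, hs⟩, h₁⟩ ⟨p₂, q'⟩ ⟨⟨t, ht⟩, h₂⟩ (rfl : q = q')
      rcases le_total s t with hst | hts
      · exact Prod.ext (hs.lower_unique hV hP hk hst ht (h₂ s)) rfl
      · exact Prod.ext (ht.lower_unique hV hP hk hts hs (h₁ t)).symm rfl
  calc _ ≤ (A ∪ B).encard := Set.encard_le_encard fun x hx =>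
        (mem_imp_or_mem_imp hV x.1 x.2).imp (fun h => ⟨hx, h⟩) (fun h => ⟨hx, h⟩)
    _ ≤ A.encard + B.encard := Set.encard_union_le _ _
    _ ≤ P.encard + P.encard := add_le_add hA hB
    _ = 2 * P.encard := (two_mul _).symm

end Nested

/-! ### Overlaps of opposite staircases in a sheared coordinate system -/

section Overlap

variable {α : Type*} {P : Set α} {u v : α → ℝ} {s t : ℝ}

/-- The points of `P` that are maximal with respect to the coordinates `u - t v` and `v`. -/
def maximalPoints (P : Set α) (u v : α → ℝ) (t : ℝ) : Set α :=
  {p | p ∈ P ∧ ∀ q ∈ P, v p < v q → u q - t * v q ≤ u p - t * v p}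

theorem monotone_maximalPoints : Monotone (maximalPoints P u v) := by
  rintro s t hst p ⟨hp, h⟩
  refine ⟨hp, fun q hq hpq => ?_⟩
  nlinarith [h q hq hpq, mul_le_mul_of_nonneg_right hst (sub_nonneg.2 hpq.le)]

/-- Two opposite maximal quadrants, supported by `x.1` and by `x.2`, overlap. -/
def Overlaps (P : Set α) (u v : α → ℝ) (t : ℝ) (x : (α × α) × (α × α)) : Prop :=
  Consec (maximalPoints P u v) v t x.1.1 x.1.2 ∧
    Consec (maximalPoints P (-u) (-v)) (-v) t x.2.1 x.2.2 ∧
    v x.1.1 < v x.2.1 ∧ u x.1.2 - t * v x.1.2 < u x.2.2 - t * v x.2.2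

/-- A half-turn exchanges the two opposite staircases while keeping the same shear `t`, so every
statement about the upper quadrant also yields one about the lower quadrant. -/
theorem Overlaps.neg {x : (α × α) × (α × α)} (h : Overlaps P u v t x) :
    Overlaps P (-u) (-v) t x.swap := by
  obtain ⟨h₁, h₂, h₃, h₄⟩ := h
  refine ⟨h₂, by simpa using h₁, by simpa using h₃, ?_⟩
  simp only [Prod.fst_swap, Prod.snd_swap, Pi.neg_apply]
  linarith

theorem overlaps_neg_swap {x : (α × α) × (α × α)} :
    Overlaps P (-u) (-v) t x.swap ↔ Overlaps P u v t x :=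
  ⟨fun h => by simpa using h.neg, Overlaps.neg⟩


/-- A maximal quadrant contains no point of `P`. -/
theorem Consec.le_of_lt (hP : P.Finite) (hv : Set.InjOn v P) {p q w : α}
    (h : Consec (maximalPoints P u v) v t p q) (hw : w ∈ P) (hpw : v p < v w) :
    u w - t * v w ≤ u q - t * v q := by
  by_contra! hlt
  -- The highest point inside the quadrant is itself maximal. Below `q` it would separate `p` from
  -- `q`; above `q` it would contradict the maximality of `q`.
  obtain ⟨z, ⟨hz, hpz, hqz⟩, hmax⟩ := Set.exists_max_image
    {z | z ∈ P ∧ v p < v z ∧ u q - t * v q < u z - t * v z} v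
    (hP.subset fun z hz => hz.1) ⟨w, hw, hpw, hlt⟩
  have hzU : z ∈ maximalPoints P u v t := by
    refine ⟨hz, fun y hy hzy => ?_⟩
    by_contra! hzy'
    exact absurd (hmax y ⟨hy, hpz.trans hzy, hqz.trans hzy'⟩) hzy.not_ge
  rcases lt_trichotomy (v z) (v q) with h₁ | h₁ | h₁
  · exact h.2.2.2 z hzU ⟨hpz, h₁⟩
  · rw [hv hz h.2.1.1 h₁] at hqz
    exact lt_irrefl _ hqz
  · exact absurd (h.2.1.2 z hz h₁) hqz.not_ge

/-- The lower supporting points of an overlap lie outside of the upper quadrant. -/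
theorem Overlaps.outside (hP : P.Finite) (hv : Set.InjOn v P) {x : (α × α) × (α × α)}
    (h : Overlaps P u v t x) :
    u x.2.1 - t * v x.2.1 ≤ u x.1.2 - t * v x.1.2 ∧ v x.2.2 ≤ v x.1.1 := by
  refine ⟨h.1.le_of_lt hP hv h.2.1.1.1 h.2.2.1, ?_⟩
  by_contra! hlt
  exact absurd (h.1.le_of_lt hP hv h.2.1.2.1.1 hlt) h.2.2.2.not_ge

theorem injOn_neg (hv : Set.InjOn v P) : Set.InjOn (-v) P :=
  fun _ ha _ hb hab => hv ha hb (neg_injective hab)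

/-- As the shear increases, an overlap persists as long as its supporting pairs do. -/
theorem Overlaps.persists (hP : P.Finite) (hv : Set.InjOn v P) {x : (α × α) × (α × α)}
    (hst : s ≤ t) (h : Overlaps P u v s x)
    (h₁ : Consec (maximalPoints P u v) v t x.1.1 x.1.2)
    (h₂ : Consec (maximalPoints P (-u) (-v)) (-v) t x.2.1 x.2.2) : Overlaps P u v t x := by
  refine ⟨h₁, h₂, h.2.2.1, ?_⟩
  have h₃ := (h.outside hP hv).2
  have h₄ := (h.neg.outside hP (injOn_neg hv)).2
  simp only [Prod.fst_swap, Prod.snd_swap, Pi.neg_apply, neg_le_neg_iff] at h₄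
  -- The point bounding the lower quadrant horizontally is no higher than the one bounding the upper
  -- quadrant, so increasing the shear can only widen the overlap.
  have h₅ : v x.2.2 ≤ v x.1.2 := h₃.trans (h.2.2.1.le.trans h₄)
  nlinarith [h.2.2.2, mul_le_mul_of_nonneg_right hst (sub_nonneg.2 h₅)]

theorem Overlaps.of_between (hP : P.Finite) (hv : Set.InjOn v P) {x : (α × α) × (α × α)}
    {r : ℝ} (hr : Overlaps P u v r x) (hrs : r ≤ s) (hst : s ≤ t) (ht : Overlaps P u v t x) :
    Overlaps P u v s x :=
  hr.persists hP hv hrs (hr.1.of_between monotone_maximalPoints hrs hst ht.1)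
    (hr.2.1.of_between monotone_maximalPoints hrs hst ht.2.1)

/-- An upper maximal quadrant overlaps at most one lower maximal quadrant at a time. -/
theorem Overlaps.unique (hP : P.Finite) (hv : Set.InjOn v P) {x : α × α} {y z : α × α}
    (hy : Overlaps P u v t (x, y)) (hz : Overlaps P u v t (x, z)) : y = z := by
  have key : ∀ {y z : α × α}, Overlaps P u v t (x, y) → Overlaps P u v t (x, z) →
      v y.1 ≤ v z.1 := by
    intro y z hy hz
    by_contra! hlt
    have hyo := (hy.outside hP hv).1
    have hzo := (hz.outside hP hv).1
    have hyh := hy.2.2.2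
    -- If `z.1` were below `y.1`, consecutiveness would put it at or below `y.2`. Maximality of
    -- `y.2` then places `z.1` at least as far in the oblique coordinate as `y.2`, hence beyond
    -- `x.2`, whereas emptiness of the upper quadrant forbids this.
    have hcon := hy.2.1.2.2.2 z.1 hz.2.1.1
    have hmax := hz.2.1.1.1
    dsimp only at hyo hzo hyh
    rcases lt_trichotomy (v z.1) (v y.2) with h₁ | h₁ | h₁
    · have := hy.2.1.2.1.2 z.1 hmax (neg_lt_neg h₁)
      simp only [Pi.neg_apply] at this
      linarith
    · rw [hv hmax hy.2.1.2.1.1 h₁] at hzo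
      linarith
    · exact hcon ⟨neg_lt_neg hlt, neg_lt_neg h₁⟩
  have h₁ : y.1 = z.1 := hv hy.2.1.1.1 hz.2.1.1.1 (le_antisymm (key hy hz) (key hz hy))
  refine Prod.ext h₁ ?_
  have h₂ := hy.2.1
  have h₃ := hz.2.1
  dsimp only at h₂ h₃
  rw [← h₁] at h₃
  exact h₂.upper_unique monotone_maximalPoints (fun t w hw => hw.1) (injOn_neg hv) le_rfl h₃
    fun _ => h₃.2.1

/-- An overlap is tight if it persists as long as its upper supporting pair does. -/
def Tight (P : Set α) (u v : α → ℝ) (x : (α × α) × (α × α)) : Prop :=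
  ∀ s t, s ≤ t → Overlaps P u v s x → Consec (maximalPoints P u v) v t x.1.1 x.1.2 →
    Overlaps P u v t x

/-- If both failed, each supporting pair would still be consecutive at some later shear without
overlap. At the smaller of these two shears both pairs are consecutive, so the overlap persists
there. -/
theorem tight_or_tight_swap (hP : P.Finite) (hv : Set.InjOn v P) (x : (α × α) × (α × α)) :
    Tight P u v x ∨ Tight P (-u) (-v) x.swap := by
  by_contra! h
  obtain ⟨h₁, h₂⟩ := h
  simp only [Tight, not_forall, overlaps_neg_swap] at h₁ h₂
  obtain ⟨s, t, hst, hs, hct, hnt⟩ := h₁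
  obtain ⟨s', t', hst', hs', hct', hnt'⟩ := h₂
  simp only [Prod.fst_swap] at hct'
  rcases le_total t t' with htt | htt
  · exact hnt (hs.persists hP hv hst hct
      (hs.2.1.of_between monotone_maximalPoints hst htt hct'))
  · exact hnt' (hs'.persists hP hv hst'
      (hs'.1.of_between monotone_maximalPoints hst' htt hct) hct')

/-- Two tight overlaps with the same upper pair coexist at the later of two shears at which they
occur, so `Overlaps.unique` identifies them. -/
theorem encard_tight_le (hP : P.Finite) (hv : Set.InjOn v P) :
    {x | (∃ t, Overlaps P u v t x) ∧ Tight P u v x}.encard ≤ 2 * P.encard := by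
  refine le_trans ?_ (encard_consec_le (V := maximalPoints P u v) monotone_maximalPoints
    (fun t w hw => hw.1) hv)
  refine Set.encard_le_encard_of_injOn (f := Prod.fst) ?_ ?_
  · rintro x ⟨⟨t, ht⟩, -⟩
    exact ⟨t, ht.1⟩
  · rintro ⟨x, y⟩ ⟨⟨s, hs⟩, hy⟩ ⟨x', z⟩ ⟨⟨t, ht⟩, hz⟩ (rfl : x = x')
    refine Prod.ext rfl ?_
    rcases le_total s t with hst | hts
    · exact (hy s t hst hs ht.1).unique hP hv ht
    · exact hs.unique hP hv (hz t s hts ht hs.1)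

/-- At most `4 |P|` overlaps ever occur. -/
theorem encard_overlaps_le (hP : P.Finite) (hv : Set.InjOn v P) :
    {x | ∃ t, Overlaps P u v t x}.encard ≤ 4 * P.encard := by
  calc _ ≤ ({x | (∃ t, Overlaps P u v t x) ∧ Tight P u v x} ∪
        Prod.swap '' {x | (∃ t, Overlaps P (-u) (-v) t x) ∧ Tight P (-u) (-v) x}).encard := by
        refine Set.encard_le_encard fun x hx => ?_
        rcases tight_or_tight_swap (u := u) hP hv x with h | h
        · exact Or.inl ⟨hx, h⟩
        · obtain ⟨t, ht⟩ := hx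
          exact Or.inr ⟨x.swap, ⟨⟨t, ht.neg⟩, h⟩, Prod.swap_swap x⟩
    _ ≤ 2 * P.encard + 2 * P.encard := (Set.encard_union_le _ _).trans
        (add_le_add (encard_tight_le hP hv)
          ((Set.encard_image_le _ _).trans (encard_tight_le hP (injOn_neg hv))))
    _ = 4 * P.encard := by rw [← add_mul]; norm_num

end Overlap

/-! ### Properties that hold on an interval of angles -/

section Interval

variable {f : ℝ → Prop} {a b x y : ℝ}

/-- Within `(a, b)`, the property `f` holds exactly on an interval. -/
def IntervalProp (a b : ℝ) (f : ℝ → Prop) : Prop :=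
  ∀ ⦃x y z⦄, a < x → x ≤ y → y ≤ z → z < b → f x → f z → f y

theorem StartsAt.exists_right (h : StartsAt f x) (hx : x < y) :
    ∃ z, x ≤ z ∧ z < y ∧ f z := by
  rcases h with ⟨h, -⟩ | ⟨-, h⟩
  · exact ⟨x, le_rfl, hx, h⟩
  · obtain ⟨z, hz, hxz⟩ := (h.and_eventually (Ioo_mem_nhdsGT hx)).exists
    exact ⟨z, hxz.1.le, hxz.2, hz⟩

theorem StartsAt.not_left (hf : IntervalProp a b f) (h : StartsAt f x) (hx : x < b)
    (hay : a < y) (hy : y < x) : ¬ f y := by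
  intro hfy
  rcases h with ⟨h, hn⟩ | ⟨hn, h⟩
  · obtain ⟨z, hz, hyz⟩ := (hn.and_eventually (Ioo_mem_nhdsLT hy)).exists
    exact hz (hf hay hyz.1.le hyz.2.le hx hfy h)
  · obtain ⟨z, hz, hyz⟩ := (h.and_eventually (Ioo_mem_nhdsGT hx)).exists
    exact hn (hf hay hy.le hyz.1.le hyz.2 hfy hz)

theorem EndsAt.exists_left (h : EndsAt f x) (hx : y < x) :
    ∃ z, y < z ∧ z ≤ x ∧ f z := by
  rcases h with ⟨-, h⟩ | ⟨h, -⟩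
  · obtain ⟨z, hz, hxz⟩ := (h.and_eventually (Ioo_mem_nhdsLT hx)).exists
    exact ⟨z, hxz.1, hxz.2.le, not_not.1 hz⟩
  · exact ⟨x, hx, le_rfl, not_not.1 h⟩

theorem EndsAt.not_right (hf : IntervalProp a b f) (h : EndsAt f x) (hx : a < x)
    (hyb : y < b) (hy : x < y) : ¬ f y := by
  intro hfy
  rcases h with ⟨hn, h⟩ | ⟨h, hn⟩
  · obtain ⟨z, hz, hyz⟩ := (h.and_eventually (Ioo_mem_nhdsLT hx)).exists
    exact hn (hf hyz.1 hyz.2.le hy.le hyb (not_not.1 hz) hfy)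
  · obtain ⟨z, hz, hyz⟩ := (hn.and_eventually (Ioo_mem_nhdsGT hy)).exists
    exact hz (hf hx hyz.1.le hyz.2.le hyb (not_not.1 h) hfy)

/-- After a start at `x`, the property holds somewhere in `[x, y)`; convexity then excludes a second
start at `y`. No openness or closedness of the interval is needed. -/
theorem StartsAt.unique (hf : IntervalProp a b f) (hx : StartsAt f x) (hy : StartsAt f y)
    (hax : a < x) (hay : a < y) (hxb : x < b) (hyb : y < b) : x = y := by
  have key : ∀ {x y}, StartsAt f x → StartsAt f y → a < x → y < b → y ≤ x := by
    intro x y hx hy hax hyb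
    by_contra! hlt
    obtain ⟨z, hxz, hzy, hz⟩ := hx.exists_right hlt
    exact hy.not_left hf hyb (hax.trans_le hxz) hzy hz
  exact le_antisymm (key hy hx hay hxb) (key hx hy hax hyb)

theorem EndsAt.unique (hf : IntervalProp a b f) (hx : EndsAt f x) (hy : EndsAt f y)
    (hax : a < x) (hay : a < y) (hxb : x < b) (hyb : y < b) : x = y := by
  have key : ∀ {x y}, EndsAt f x → EndsAt f y → a < x → y < b → y ≤ x := by
    intro x y hx hy hax hyb
    by_contra! hlt
    obtain ⟨z, hxz, hzy, hz⟩ := hy.exists_left hlt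
    exact hx.not_right hf hax (hzy.trans_lt hyb) hxz hz
  exact le_antisymm (key hy hx hay hxb) (key hx hy hax hyb)

variable {ι : Type*} {F : ι → ℝ → Prop}

theorem encard_startsAt_le (hF : ∀ i, IntervalProp a b (F i)) :
    {x : ℝ × ι | a < x.1 ∧ x.1 < b ∧ StartsAt (F x.2) x.1}.encard ≤
      {i | ∃ t, a < t ∧ t < b ∧ F i t}.encard := by
  refine Set.encard_le_encard_of_injOn (f := Prod.snd) ?_ ?_
  · rintro x ⟨h₁, h₂, h⟩
    obtain ⟨z, hz, hzb, hfz⟩ := h.exists_right h₂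
    exact ⟨z, h₁.trans_le hz, hzb, hfz⟩
  · rintro ⟨x, i⟩ ⟨h₁, h₂, h⟩ ⟨y, j⟩ ⟨h₁', h₂', h'⟩ (rfl : i = j)
    exact Prod.ext (h.unique (hF i) h' h₁ h₁' h₂ h₂') rfl

theorem encard_endsAt_le (hF : ∀ i, IntervalProp a b (F i)) :
    {x : ℝ × ι | a < x.1 ∧ x.1 < b ∧ EndsAt (F x.2) x.1}.encard ≤
      {i | ∃ t, a < t ∧ t < b ∧ F i t}.encard := by
  refine Set.encard_le_encard_of_injOn (f := Prod.snd) ?_ ?_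
  · rintro x ⟨h₁, h₂, h⟩
    obtain ⟨z, hz, hzb, hfz⟩ := h.exists_left h₁
    exact ⟨z, hz, hzb.trans_lt h₂, hfz⟩
  · rintro ⟨x, i⟩ ⟨h₁, h₂, h⟩ ⟨y, j⟩ ⟨h₁', h₂', h'⟩ (rfl : i = j)
    exact Prod.ext (h.unique (hF i) h' h₁ h₁' h₂ h₂') rfl

end Interval

/-! ### The vertices of the staircases -/

theorem Kind.signX_mul_self (σ : Kind) : σ.signX * σ.signX = 1 := by
  cases σ <;> norm_num [Kind.signX]

theorem Kind.signY_mul_self (σ : Kind) : σ.signY * σ.signY = 1 := by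
  cases σ <;> norm_num [Kind.signY]

theorem Kind.signX_opp (σ : Kind) : σ.opp.signX = -σ.signX := by
  cases σ <;> simp [Kind.signX, Kind.opp]

theorem Kind.signY_opp (σ : Kind) : σ.opp.signY = -σ.signY := by
  cases σ <;> simp [Kind.signY, Kind.opp]

theorem Kind.continuous_h (σ : Kind) (β : ℝ) : Continuous (σ.h β) := by
  unfold Kind.h obliqueX; fun_prop

theorem Kind.continuous_k (σ : Kind) : Continuous σ.k := by
  unfold Kind.k; fun_prop

/-- The point with the given oriented coordinates. -/
noncomputable def Kind.point (σ : Kind) (β x y : ℝ) : ℝ × ℝ :=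
  (σ.signX * x + σ.signY * y * Real.cot β, σ.signY * y)

theorem Kind.h_point (σ : Kind) (β x y : ℝ) : σ.h β (σ.point β x y) = x := by
  simp only [Kind.h, Kind.point, obliqueX]
  linear_combination x * σ.signX_mul_self

theorem Kind.k_point (σ : Kind) (β x y : ℝ) : σ.k (σ.point β x y) = y := by
  simp only [Kind.k, Kind.point]
  linear_combination y * σ.signY_mul_self

theorem Kind.point_self (σ : Kind) (β : ℝ) (z : ℝ × ℝ) : σ.point β (σ.h β z) (σ.k z) = z := by
  ext
  · simp only [Kind.h, Kind.k, Kind.point, obliqueX]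
    linear_combination (z.1 - z.2 * Real.cot β) * σ.signX_mul_self +
      z.2 * Real.cot β * σ.signY_mul_self
  · simp only [Kind.k, Kind.point]
    linear_combination z.2 * σ.signY_mul_self

theorem mem_closure_quadrant (β : ℝ) (σ : Kind) (a : ℝ × ℝ) : a ∈ closure (quadrant β σ a) := by
  have hc : Continuous fun ε : ℝ => σ.point β (σ.h β a + ε) (σ.k a + ε) := by
    unfold Kind.point; fun_prop
  have ht : Tendsto (fun ε : ℝ => σ.point β (σ.h β a + ε) (σ.k a + ε)) (𝓝[>] 0) (𝓝 a) := by
    have := (hc.tendsto 0).mono_left (nhdsWithin_le_nhds (s := Set.Ioi 0))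
    simpa only [add_zero, Kind.point_self] using this
  refine mem_closure_of_tendsto ht (eventually_mem_nhdsWithin.mono fun ε hε => ?_)
  have hε : 0 < ε := hε
  simp only [quadrant, Set.mem_ofPred_eq, Kind.h_point, Kind.k_point]
  constructor <;> linarith

variable {P : Finset (ℝ × ℝ)} {β : ℝ} {σ : Kind} {p : ℝ × ℝ}

theorem mem_sideRegion (hp : p ∈ P) : p ∈ sideRegion P β σ :=
  fun _ ha hpa => ha p hp hpa

/-- If `q ∈ P` lies in the quadrant at `p`, then any quadrant of kind `σ` reaching a point near `p`
contains `q` and is not free, so `p` is interior. Otherwise the quadrant at `p` is itself free and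
accumulates at `p`. -/
theorem mem_frontier_sideRegion_iff (hp : p ∈ P) :
    p ∈ frontier (sideRegion P β σ) ↔ PFree P (quadrant β σ p) := by
  rw [frontier_eq_closure_inter_closure]
  constructor
  · rintro ⟨-, h⟩ q hq ⟨hh, hk⟩
    have hopen : IsOpen {z | σ.h β z < σ.h β q ∧ σ.k z < σ.k q} :=
      (isOpen_lt (σ.continuous_h β) continuous_const).inter
        (isOpen_lt σ.continuous_k continuous_const)
    obtain ⟨z, ⟨hzh, hzk⟩, hz⟩ := mem_closure_iff.1 h _ hopen ⟨hh, hk⟩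
    refine hz fun a ha hza => ha q hq ⟨hza.1.trans hzh, hza.2.trans hzk⟩
  · intro h
    refine ⟨subset_closure (mem_sideRegion hp), ?_⟩
    exact closure_mono (fun z hz hz' => hz' p h hz) (mem_closure_quadrant β σ p)

theorem mem_hullVertices (hp : p ∈ P) (h : PFree P (quadrant β σ p)) : p ∈ hullVertices P β := by
  refine ⟨hp, ?_⟩
  rw [frontier_eq_closure_inter_closure]
  refine ⟨subset_closure fun _ _ ha hpa => ha p hp hpa, ?_⟩
  exact closure_mono (fun z hz hz' => hz' σ p h hz) (mem_closure_quadrant β σ p)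

/-- The extreme vertices required by `staircase` impose nothing new: extreme points of `P` have free
quadrants, hence are hull vertices, and maximality of `p` places it between them. -/
theorem mem_stairVertices_iff (hy : Set.InjOn Prod.snd (P : Set (ℝ × ℝ))) :
    p ∈ stairVertices P β σ ↔ p ∈ P ∧ ∀ q ∈ P, σ.k p < σ.k q → σ.h β q ≤ σ.h β p := by
  have hfree : PFree P (quadrant β σ p) ↔ ∀ q ∈ P, σ.k p < σ.k q → σ.h β q ≤ σ.h β p := by
    refine forall₂_congr fun q hq => ?_
    simp only [quadrant, Set.mem_ofPred_eq, not_and', not_lt]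
  constructor
  · rintro ⟨⟨hp, -⟩, hf, -⟩
    exact ⟨hp, hfree.1 ((mem_frontier_sideRegion_iff hp).1 hf)⟩
  · rintro ⟨hp, h⟩
    have hpf := hfree.2 h
    have hpv := mem_hullVertices hp hpf
    refine ⟨hpv, (mem_frontier_sideRegion_iff hp).2 hpf, ?_⟩
    obtain ⟨t, ht, htmax⟩ := P.exists_max_image σ.k ⟨p, hp⟩
    have htv : t ∈ hullVertices P β := mem_hullVertices (σ := σ) ht
      fun q hq hq' => absurd (htmax q hq) hq'.2.not_ge
    have htp : σ.h β t ≤ σ.h β p := by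
      rcases (htmax p hp).lt_or_eq with hlt | heq
      · exact h t ht hlt
      · have h2 : p.2 = t.2 := by
          have := congrArg (σ.signY * ·) heq
          simpa only [Kind.k, ← mul_assoc, σ.signY_mul_self, one_mul] using this
        rw [hy hp ht h2]
    obtain ⟨r, hr, hrmax⟩ := P.exists_max_image (σ.h β) ⟨p, hp⟩
    -- Several points may tie for the horizontal extreme. If `p` is one of them it serves as the
    -- extreme vertex itself, because another choice might lie above it.
    by_cases hrp : σ.h β r ≤ σ.h β p
    · exact ⟨p, hpv, t, htv, fun q hq => (hrmax q hq.1).trans hrp, fun q hq => htmax q hq.1,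
        htp, le_rfl⟩
    · refine ⟨r, mem_hullVertices (σ := σ) hr fun q hq hq' => absurd (hrmax q hq) hq'.1.not_ge,
        t, htv, fun q hq => hrmax q hq.1, fun q hq => htmax q hq.1, htp, ?_⟩
      by_contra! hlt
      exact hrp (h r hr hlt)

/-! ### Reduction to the sheared coordinate system -/

/-- The oriented shear at the angle `β`. -/
noncomputable def Kind.shear (σ : Kind) (β : ℝ) : ℝ := σ.signX * σ.signY * Real.cot β

theorem Kind.shear_opp (σ : Kind) (β : ℝ) : σ.opp.shear β = σ.shear β := by
  simp [Kind.shear, Kind.signX_opp, Kind.signY_opp]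

/-- The first coordinate, oriented towards the side of `σ`. -/
noncomputable def Kind.u (σ : Kind) (z : ℝ × ℝ) : ℝ := σ.signX * z.1

theorem Kind.u_opp (σ : Kind) : σ.opp.u = -σ.u := by
  ext z; simp [Kind.u, Kind.signX_opp]

theorem Kind.k_opp (σ : Kind) : σ.opp.k = -σ.k := by
  ext z; simp [Kind.k, Kind.signY_opp]

theorem Kind.h_eq (σ : Kind) (β : ℝ) (z : ℝ × ℝ) : σ.h β z = σ.u z - σ.shear β * σ.k z := by
  simp only [Kind.h, Kind.u, Kind.shear, Kind.k, obliqueX]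
  linear_combination σ.signX * Real.cot β * z.2 * σ.signY_mul_self

theorem Kind.h_opp (σ : Kind) (β : ℝ) (z : ℝ × ℝ) : σ.opp.h β z = -σ.h β z := by
  simp [Kind.h, Kind.signX_opp]

theorem Kind.injOn_k (σ : Kind) (hy : Set.InjOn Prod.snd (P : Set (ℝ × ℝ))) :
    Set.InjOn σ.k (P : Set (ℝ × ℝ)) := by
  intro a ha b hb hab
  refine hy ha hb ?_
  have := congrArg (σ.signY * ·) hab
  simpa only [Kind.k, ← mul_assoc, σ.signY_mul_self, one_mul] using this

theorem antitoneOn_cot : AntitoneOn Real.cot (Set.Ioo 0 Real.pi) := by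
  intro x hx y hy hxy
  have hsx := Real.sin_pos_of_pos_of_lt_pi hx.1 hx.2
  have hsy := Real.sin_pos_of_pos_of_lt_pi hy.1 hy.2
  rw [Real.cot_eq_cos_div_sin, Real.cot_eq_cos_div_sin, div_le_div_iff₀ hsy hsx]
  have := Real.sin_nonneg_of_nonneg_of_le_pi (x := y - x) (by linarith)
    (by linarith [hx.1, hy.2])
  rw [Real.sin_sub] at this
  linarith

theorem Kind.shear_monotoneOn_or (σ : Kind) :
    MonotoneOn σ.shear (Set.Ioo 0 Real.pi) ∨ AntitoneOn σ.shear (Set.Ioo 0 Real.pi) := by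
  have h := antitoneOn_cot
  cases σ
  · right; intro x hx y hy hxy; simpa [Kind.shear, Kind.signX, Kind.signY] using h hx hy hxy
  · left; intro x hx y hy hxy; simpa [Kind.shear, Kind.signX, Kind.signY] using h hx hy hxy
  · right; intro x hx y hy hxy; simpa [Kind.shear, Kind.signX, Kind.signY] using h hx hy hxy
  · left; intro x hx y hy hxy; simpa [Kind.shear, Kind.signX, Kind.signY] using h hx hy hxy

theorem Kind.intervalProp_comp_shear (σ : Kind) {f : ℝ → Prop}
    (hf : ∀ ⦃r s t⦄, r ≤ s → s ≤ t → f r → f t → f s) :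
    IntervalProp 0 Real.pi fun β => f (σ.shear β) := by
  intro x y z hx hxy hyz hz hfx hfz
  have hx' : x ∈ Set.Ioo 0 Real.pi := ⟨hx, by linarith⟩
  have hy' : y ∈ Set.Ioo 0 Real.pi := ⟨by linarith, by linarith⟩
  have hz' : z ∈ Set.Ioo 0 Real.pi := ⟨by linarith, hz⟩
  rcases σ.shear_monotoneOn_or with h | h
  · exact hf (h hx' hy' hxy) (h hy' hz' hyz) hfx hfz
  · exact hf (h hy' hz' hyz) (h hx' hy' hxy) hfz hfx

theorem stairVertices_eq (hy : Set.InjOn Prod.snd (P : Set (ℝ × ℝ))) :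
    stairVertices P β σ = maximalPoints (P : Set (ℝ × ℝ)) σ.u σ.k (σ.shear β) := by
  ext p
  rw [mem_stairVertices_iff hy]
  simp only [maximalPoints, Kind.h_eq, Set.mem_ofPred_eq, Finset.mem_coe]

theorem consecutive_iff (hy : Set.InjOn Prod.snd (P : Set (ℝ × ℝ))) {p q : ℝ × ℝ} :
    Consecutive P β σ p q ↔
      Consec (maximalPoints (P : Set (ℝ × ℝ)) σ.u σ.k) σ.k (σ.shear β) p q := by
  simp only [Consecutive, Consec, stairVertices_eq hy]

/-- The apex has the height of the first supporting point and the oblique abscissa of the second, so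
opposite quadrants meet exactly when two open intervals are nonempty. -/
theorem nonempty_inter_supportedQuadrant_iff {p q p' q' : ℝ × ℝ} :
    (supportedQuadrant β σ p q ∩ supportedQuadrant β σ.opp p' q').Nonempty ↔
      σ.k p < σ.k p' ∧ σ.h β q < σ.h β q' := by
  have hk (p q : ℝ × ℝ) : σ.k (corner β p q) = σ.k p := rfl
  have hh (p q : ℝ × ℝ) : σ.h β (corner β p q) = σ.h β q := by
    simp only [Kind.h, corner, obliqueX]; ring
  simp only [supportedQuadrant, quadrant, Set.Nonempty, Set.mem_inter_iff, Set.mem_ofPred_eq,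
    Kind.h_opp, Kind.k_opp, Pi.neg_apply, neg_lt_neg_iff, hk, hh]
  constructor
  · rintro ⟨z, ⟨h₁, h₂⟩, h₃, h₄⟩
    exact ⟨h₂.trans h₄, h₁.trans h₃⟩
  · rintro ⟨h₁, h₂⟩
    obtain ⟨x, hx, hx'⟩ := exists_between h₂
    obtain ⟨y, hy, hy'⟩ := exists_between h₁
    exact ⟨σ.point β x y, by simp only [Kind.h_point, Kind.k_point]; exact ⟨⟨hx, hy⟩, hx', hy'⟩⟩

/-- The two supporting pairs of a region. -/
def RegionLabel.pairs (r : RegionLabel) : ((ℝ × ℝ) × (ℝ × ℝ)) × ((ℝ × ℝ) × (ℝ × ℝ)) :=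
  ((r.p, r.q), (r.p', r.q'))

theorem isOverlapping_iff (hy : Set.InjOn Prod.snd (P : Set (ℝ × ℝ))) {r : RegionLabel} :
    IsOverlapping P β r ↔ (r.kind = Kind.topRight ∨ r.kind = Kind.topLeft) ∧
      Overlaps (P : Set (ℝ × ℝ)) r.kind.u r.kind.k (r.kind.shear β) r.pairs := by
  simp only [IsOverlapping, Overlaps, consecutive_iff hy, nonempty_inter_supportedQuadrant_iff,
    Kind.u_opp, Kind.k_opp, Kind.shear_opp, Kind.h_eq, RegionLabel.pairs]

theorem encard_isOverlapping_le (hy : Set.InjOn Prod.snd (P : Set (ℝ × ℝ))) :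
    {r | ∃ β, 0 < β ∧ β < Real.pi ∧ IsOverlapping P β r}.encard ≤ 8 * (P : Set (ℝ × ℝ)).encard := by
  have key (σ : Kind) : {r : RegionLabel | r.kind = σ ∧
      ∃ t, Overlaps (P : Set (ℝ × ℝ)) σ.u σ.k t r.pairs}.encard ≤
      4 * (P : Set (ℝ × ℝ)).encard := by
    refine le_trans (Set.encard_le_encard_of_injOn (f := RegionLabel.pairs) ?_ ?_)
      (encard_overlaps_le (u := σ.u) P.finite_toSet (σ.injOn_k hy))
    · exact fun r hr => hr.2
    · rintro ⟨_, p, q, p', q'⟩ ⟨rfl, -⟩ ⟨_, a, b, c, d⟩ ⟨rfl, -⟩ h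
      simp only [RegionLabel.pairs, Prod.mk.injEq] at h
      obtain ⟨⟨rfl, rfl⟩, rfl, rfl⟩ := h
      rfl
  refine le_trans (Set.encard_le_encard fun r hr => ?_) ((Set.encard_union_le _ _).trans
    (add_le_add (key .topRight) (key .topLeft)) |>.trans_eq (by rw [← add_mul]; norm_num))
  obtain ⟨β, -, -, h⟩ := hr
  obtain ⟨h₁, h₂⟩ := (isOverlapping_iff hy).1 h
  exact h₁.imp (fun e => ⟨e, _, e ▸ h₂⟩) (fun e => ⟨e, _, e ▸ h₂⟩)

theorem encard_stairVertices_le :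
    {x : Kind × (ℝ × ℝ) | ∃ β, 0 < β ∧ β < Real.pi ∧ x.2 ∈ stairVertices P β x.1}.encard ≤
      4 * (P : Set (ℝ × ℝ)).encard := by
  have key (σ : Kind) : (Prod.mk σ '' (P : Set (ℝ × ℝ))).encard ≤ (P : Set (ℝ × ℝ)).encard :=
    Set.encard_image_le _ _
  refine le_trans (Set.encard_le_encard fun x hx => ?_) ((Set.encard_union_le _ _).trans
    (add_le_add ((Set.encard_union_le _ _).trans (add_le_add (key .topRight) (key .topLeft)))
      ((Set.encard_union_le _ _).trans (add_le_add (key .bottomLeft) (key .bottomRight))))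
    |>.trans_eq ?_)
  · obtain ⟨σ, p⟩ := x
    obtain ⟨β, -, -, h⟩ := hx
    have hp : p ∈ P := h.1.1
    cases σ <;> simp [hp]
  · rw [← two_mul, ← two_mul, ← mul_assoc]; norm_num

theorem intervalProp_stairVertices (hy : Set.InjOn Prod.snd (P : Set (ℝ × ℝ)))
    (x : Kind × (ℝ × ℝ)) : IntervalProp 0 Real.pi fun β => x.2 ∈ stairVertices P β x.1 := by
  simp only [stairVertices_eq hy]
  exact x.1.intervalProp_comp_shear
    (f := fun t => x.2 ∈ maximalPoints (P : Set (ℝ × ℝ)) x.1.u x.1.k t)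
    fun r s t hrs _ hr _ => monotone_maximalPoints hrs hr

theorem intervalProp_isOverlapping (hy : Set.InjOn Prod.snd (P : Set (ℝ × ℝ)))
    (r : RegionLabel) : IntervalProp 0 Real.pi fun β => IsOverlapping P β r := by
  simp only [isOverlapping_iff hy]
  exact r.kind.intervalProp_comp_shear (f := fun t => _ ∧ Overlaps (P : Set (ℝ × ℝ)) _ _ t _)
    fun _ _ _ hrs hst hr ht =>
      ⟨hr.1, hr.2.of_between P.finite_toSet (r.kind.injOn_k hy) hrs hst ht.2⟩

theorem encard_sweepEvents_le (hy : Set.InjOn Prod.snd (P : Set (ℝ × ℝ))) :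
    (sweepEvents P).encard ≤ 24 * (P : Set (ℝ × ℝ)).encard := by
  have hS := intervalProp_stairVertices hy
  have hO := intervalProp_isOverlapping hy
  have h₁ := (Set.encard_image_le (fun x : ℝ × Kind × (ℝ × ℝ) => Event.insertion x.1 x.2.1 x.2.2)
    _).trans ((encard_startsAt_le hS).trans encard_stairVertices_le)
  have h₂ := (Set.encard_image_le (fun x : ℝ × Kind × (ℝ × ℝ) => Event.deletion x.1 x.2.1 x.2.2)
    _).trans ((encard_endsAt_le hS).trans encard_stairVertices_le)
  have h₃ := (Set.encard_image_le (fun x : ℝ × RegionLabel => Event.overlap x.1 x.2)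
    _).trans ((encard_startsAt_le hO).trans (encard_isOverlapping_le hy))
  have h₄ := (Set.encard_image_le (fun x : ℝ × RegionLabel => Event.release x.1 x.2)
    _).trans ((encard_endsAt_le hO).trans (encard_isOverlapping_le hy))
  refine le_trans (Set.encard_le_encard fun e he => ?_) ((Set.encard_union_le _ _).trans
    (add_le_add ((Set.encard_union_le _ _).trans (add_le_add h₁ h₂))
      ((Set.encard_union_le _ _).trans (add_le_add h₃ h₄))) |>.trans_eq ?_)
  · obtain ⟨h0, hpi, h⟩ := he
    cases e with
    | insertion β σ p => exact Or.inl (Or.inl ⟨(β, σ, p), ⟨h0, hpi, h⟩, rfl⟩)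
    | deletion β σ p => exact Or.inl (Or.inr ⟨(β, σ, p), ⟨h0, hpi, h⟩, rfl⟩)
    | overlap β r => exact Or.inr (Or.inl ⟨(β, r), ⟨h0, hpi, h⟩, rfl⟩)
    | release β r => exact Or.inr (Or.inr ⟨(β, r), ⟨h0, hpi, h⟩, rfl⟩)
  -- Insertions and deletions contribute 4 each, overlaps and releases 8 each.
  · rw [← add_mul, ← add_mul, ← add_mul]; norm_num

end BetaHull

theorem mainTheorem8 :
    ∃ C : ℕ, ∀ P : Finset (ℝ × ℝ), BetaHull.GeneralPosition P →
      (BetaHull.sweepEvents P).Finite ∧ (BetaHull.sweepEvents P).ncard ≤ C * P.card := by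
  refine ⟨24, fun P hP => ?_⟩
  have hy : Set.InjOn Prod.snd (P : Set (ℝ × ℝ)) := fun p hp q hq hpq =>
    by_contra fun hne => hP.2 p hp q hq hne hpq
  have h := BetaHull.encard_sweepEvents_le hy
  rw [Set.encard_coe_eq_coe_finsetCard] at h
  have h' : (BetaHull.sweepEvents P).encard ≤ ((24 * P.card : ℕ) : ℕ∞) := by exact_mod_cast h
  have hfin : (BetaHull.sweepEvents P).Finite := Set.finite_of_encard_le_coe h'
  refine ⟨hfin, ?_⟩
  rw [← hfin.cast_ncard_eq] at h'
  exact_mod_cast h'
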